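/- For real $q$ with $|q|<1$ and an integer $k\ge 1$ let $$S_k(q)=\sum_{j=1}^{\infty}\frac{1}{j^k}\,\frac{q^j}{1-q^j},$$ let $q_7=e^{-\pi\sqrt7}$ and $\sqrt{-7}=i\sqrt7$, let $B_j$ be the $j$-th Bernoulli number, and for an integer $n\ge 1$ and complex $z\neq0$ let $$H_n(z)=(-1)^{n+1}\sum_{m=0}^{n+1}z^{2m-1}\binom{2n+2}{2m}B_{2m}B_{2n+2-2m}.$$ Let $n\ge1$ and $k=2n+1$. Then $$a_n=2^{2n+1}-\left(\frac{1+\sqrt{-7}}{2}\right)^{2n}-\left(\frac{1-\sqrt{-7}}{2}\right)^{2n}$$ is a positive integer, and $$\zeta(k)=A_{k,0}\sqrt7\,\pi^k+\sum_{d\in\{1,2,4\}}A_{k,d}\,S_k(q_7^d),$$ where the three Lambert series converge and $A_{k,0},A_{k,1},A_{k,2},A_{k,4}$ are the rational numbers determined by $$A_{k,1}=2^{2n}A_{k,4}=2+\frac{2}{a_n},\qquad \sum_{d\in\{1,2,4\}}A_{k,d}=-2,$$ $$\frac{(2n+3)!}{2^{2n-1}}\,a_n\,A_{k,0}=\frac{(2n+3)\,2^{2n+3}}{\sqrt7}\,\operatorname{Im}H_n\!\left(\frac{1+\sqrt{-7}}{4}\right).$$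 -/

import Mathlib

/-- The Lambert series `S_k(q) = ∑_{n ≥ 1} n^{-k} q^n / (1 - q^n)`, for real `q` with `|q| < 1`;
the summation index is shifted by one, so that it starts at `0`. -/
noncomputable def lambertTerm (k : ℕ) (q : ℝ) (j : ℕ) : ℝ :=
  1 / ((j : ℝ) + 1) ^ k * (q ^ (j + 1) / (1 - q ^ (j + 1)))

/-- The sum `S_k(q)` of the Lambert series. -/
noncomputable def lambertS (k : ℕ) (q : ℝ) : ℝ :=
  ∑' j : ℕ, lambertTerm k q j

/-- `q_7 = exp (-π √7)`. -/
noncomputable def q7 : ℝ := Real.exp (-Real.pi * Real.sqrt 7)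

/-- `√(-7) = i √7`. -/
noncomputable def sqrtNegSeven : ℂ := Complex.I * (Real.sqrt 7 : ℂ)

/-- `H_n(z) = (-1)^{n+1} ∑_{m=0}^{n+1} z^{2m-1} binom(2n+2, 2m) B_{2m} B_{2n+2-2m}`,
with Bernoulli numbers `B_j`; the term with `m = 0` has the exponent `-1`. -/
noncomputable def bernoulliH (n : ℕ) (z : ℂ) : ℂ :=
  (-1) ^ (n + 1) * ∑ m ∈ Finset.range (n + 2),
    z ^ (2 * (m : ℤ) - 1) * ((2 * n + 2).choose (2 * m) : ℂ) *
      (bernoulli (2 * m) : ℂ) * (bernoulli (2 * n + 2 - 2 * m) : ℂ)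

/-! Let `F(t) = ζ(k)/2 + S_k(e^{2πit})`. Partial fractions of the cotangent turn `F` into a double
series over `1/(j^{2n}((jt)² - m²))`; comparing it with the same series at `-1/t`, the summands
differ by products of even zeta terms, so `F(t) - t^{2n} F(-1/t)` is an explicit multiple of
`H_n(t)` (`lambertEichler_sub_inversion`).

At `t = (1+√-7)/4` one has `e^{2πit} = i√q₇`, while `-1/t` gives the real point `-q₇`. In real
parts, the parity relation `complexLambert_add_neg` reduces both Lambert values to `S_k` at `q₇`,
`q₇²`, `q₇⁴` (`zeta_lambert_relation`). Since `a_n = 2^{2n+1}(1 - Re t^{2n})` is positive, the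
relation can be solved for `ζ(k)`. -/

/-! ### Lambert series at complex points and their parity relation. -/

/-- The terms of the Lambert series at a complex point. -/
noncomputable def complexLambertTerm (k : ℕ) (x : ℂ) (j : ℕ) : ℂ :=
  1 / ((j : ℂ) + 1) ^ k * (x ^ (j + 1) / (1 - x ^ (j + 1)))

/-- The Lambert series at a complex point. -/
noncomputable def complexLambert (k : ℕ) (x : ℂ) : ℂ :=
  ∑' j : ℕ, complexLambertTerm k x j

theorem one_sub_pow_succ_ne_zero {x : ℂ} (hx : ‖x‖ < 1) (j : ℕ) : 1 - x ^ (j + 1) ≠ 0 := by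
  intro h
  have h1 : ‖x ^ (j + 1)‖ = 1 := by rw [← sub_eq_zero.mp h]; simp
  rw [norm_pow] at h1
  exact absurd h1 (pow_lt_one₀ (norm_nonneg x) hx (by omega)).ne

theorem summable_complexLambertTerm (k : ℕ) {x : ℂ} (hx : ‖x‖ < 1) :
    Summable (complexLambertTerm k x) := by
  have hg : Summable fun j : ℕ => ‖x‖ ^ j * (‖x‖ / (1 - ‖x‖)) :=
    (summable_geometric_of_lt_one (norm_nonneg x) hx).mul_right _
  refine Summable.of_norm_bounded hg fun j => ?_
  have h1 : ‖(1 : ℂ) / ((j : ℂ) + 1) ^ k‖ ≤ 1 := by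
    rw [norm_div, norm_one, norm_pow, show ((j : ℂ) + 1) = ((j + 1 : ℕ) : ℂ) by push_cast; rfl,
      Complex.norm_natCast]
    refine div_le_one_of_le₀ (one_le_pow₀ ?_) (by positivity)
    push_cast; linarith [(Nat.cast_nonneg j : (0 : ℝ) ≤ j)]
  have h2 : 1 - ‖x‖ ≤ ‖1 - x ^ (j + 1)‖ := by
    have h3 := norm_sub_norm_le (1 : ℂ) (x ^ (j + 1))
    rw [norm_one, norm_pow] at h3
    have h4 : ‖x‖ ^ (j + 1) ≤ ‖x‖ := pow_le_of_le_one (norm_nonneg x) hx.le (by omega)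
    linarith
  have h5 : ‖x ^ (j + 1) / (1 - x ^ (j + 1))‖ ≤ ‖x‖ ^ j * (‖x‖ / (1 - ‖x‖)) := by
    rw [norm_div, norm_pow, pow_succ, mul_div_assoc]
    have : 0 < 1 - ‖x‖ := by linarith
    gcongr
  rw [complexLambertTerm, norm_mul]
  calc _ ≤ 1 * (‖x‖ ^ j * (‖x‖ / (1 - ‖x‖))) := by gcongr
    _ = _ := one_mul _

theorem complexLambertTerm_ofReal (k : ℕ) (q : ℝ) (j : ℕ) :
    complexLambertTerm k (q : ℂ) j = (lambertTerm k q j : ℂ) := by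
  simp [complexLambertTerm, lambertTerm]

theorem complexLambert_ofReal (k : ℕ) (q : ℝ) :
    complexLambert k (q : ℂ) = (lambertS k q : ℂ) := by
  simp only [complexLambert, lambertS, complexLambertTerm_ofReal, Complex.ofReal_tsum]

theorem summable_lambertTerm (k : ℕ) {q : ℝ} (hq : |q| < 1) : Summable (lambertTerm k q) := by
  have h := summable_complexLambertTerm k (x := (q : ℂ)) (by simpa using hq)
  rw [funext (complexLambertTerm_ofReal k q)] at h
  exact Complex.summable_ofReal.mp h

theorem complexLambert_conj (k : ℕ) (x : ℂ) :
    (starRingEnd ℂ) (complexLambert k x) = complexLambert k ((starRingEnd ℂ) x) := by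
  rw [complexLambert, complexLambert, Complex.conj_tsum]
  simp [complexLambertTerm]

theorem hasSum_complexLambert (k : ℕ) {x : ℂ} (hx : ‖x‖ < 1) :
    HasSum (fun j : ℕ => 1 / (j + 1 : ℂ) ^ k * (x ^ (j + 1) / (1 - x ^ (j + 1))))
      (complexLambert k x) :=
  (summable_complexLambertTerm k hx).hasSum

/-- The parity relation behind the Hecke operator `T₂`. -/
theorem complexLambert_add_neg (k : ℕ) {x : ℂ} (hx : ‖x‖ < 1) :
    complexLambert k x + complexLambert k (-x) =
      2 * ((1 + 1 / 2 ^ k) * complexLambert k (x ^ 2) - 1 / 2 ^ k * complexLambert k (x ^ 4)) := by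
  have hx2 : ‖x ^ 2‖ < 1 := by rw [norm_pow]; exact pow_lt_one₀ (norm_nonneg x) hx (by norm_num)
  have hx4 : ‖x ^ 4‖ < 1 := by rw [norm_pow]; exact pow_lt_one₀ (norm_nonneg x) hx (by norm_num)
  have hs := (hasSum_complexLambert k hx).add (hasSum_complexLambert k (x := -x) (by simpa using hx))
  -- Because of the index shift, odd indices carry the even exponents, whose part of `S_k(x²)` is
  -- `2^{-k} S_k(x⁴)`.
  have hA : HasSum (fun m : ℕ => complexLambertTerm k (x ^ 2) (2 * m + 1))
      (1 / 2 ^ k * complexLambert k (x ^ 4)) := by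
    convert! (hasSum_complexLambert k hx4).mul_left (1 / 2 ^ k) using 2 with m
    rw [complexLambertTerm, ← pow_mul, ← pow_mul,
      show 2 * (2 * m + 1 + 1) = 4 * (m + 1) by ring,
      show (((2 * m + 1 : ℕ) : ℂ) + 1) = 2 * ((m : ℂ) + 1) by push_cast; ring, mul_pow,
      ← mul_assoc, one_div_mul_one_div]
  have hB : HasSum (fun m : ℕ => complexLambertTerm k (x ^ 2) (2 * m))
      (complexLambert k (x ^ 2) - 1 / 2 ^ k * complexLambert k (x ^ 4)) := by
    have hsB : Summable fun m : ℕ => complexLambertTerm k (x ^ 2) (2 * m) :=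
      (summable_complexLambertTerm k hx2).comp_injective (i := fun m => 2 * m)
        fun a b h => by simpa using h
    have h1 := hsB.hasSum.even_add_odd hA
    have h2 := h1.unique (hasSum_complexLambert k hx2)
    rw [← h2, add_sub_cancel_right]
    exact hsB.hasSum
  have hC := (hasSum_complexLambert k hx2).mul_left (2 * (1 / 2 ^ k))
  have h := HasSum.even_add_odd (f := fun j : ℕ => 1 / (j + 1 : ℂ) ^ k *
      (x ^ (j + 1) / (1 - x ^ (j + 1))) + 1 / (j + 1 : ℂ) ^ k *
      ((-x) ^ (j + 1) / (1 - (-x) ^ (j + 1))))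
    (m := 2 * (complexLambert k (x ^ 2) - 1 / 2 ^ k * complexLambert k (x ^ 4)))
    (m' := 2 * (1 / 2 ^ k) * complexLambert k (x ^ 2)) ?_ ?_
  · rw [hs.unique h]; ring
  -- Odd exponents: `y/(1-y) - y/(1+y) = 2y²/(1-y²)`. For even ones the two terms coincide.
  · convert! hB.mul_left 2 using 2 with m
    have h1 := one_sub_pow_succ_ne_zero hx (2 * m)
    have h2 := one_sub_pow_succ_ne_zero (x := -x) (by simpa using hx) (2 * m)
    have h3 := one_sub_pow_succ_ne_zero hx2 (2 * m)
    rw [(show Odd (2 * m + 1) from ⟨m, rfl⟩).neg_pow] at h2 ⊢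
    rw [complexLambertTerm]
    rw [pow_right_comm x 2 (2 * m + 1)] at h3 ⊢
    push_cast
    generalize x ^ (2 * m + 1) = y at *
    rw [← mul_add, mul_left_comm]
    congr 1
    field_simp
    ring
  · convert! hC using 2 with m
    rw [show 2 * m + 1 + 1 = 2 * (m + 1) by ring, (even_two_mul (m + 1)).neg_pow, pow_mul,
      show (((2 * m + 1 : ℕ) : ℂ) + 1) = 2 * ((m : ℂ) + 1) by push_cast; ring, mul_pow,
      ← one_div_mul_one_div]
    ring

/-! ### The transformation of the Eichler integral under `t ↦ -1/t`. -/

/-- The Eichler integral `ζ(k)/2 + ∑ j^{-k} q^j/(1-q^j)` at `q = exp (2πit)`. -/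
noncomputable def lambertEichler (k : ℕ) (t : ℂ) : ℂ :=
  riemannZeta k / 2 + complexLambert k (Complex.exp (2 * Real.pi * Complex.I * t))

theorem norm_exp_two_pi_I_mul_lt_one {t : ℂ} (ht : 0 < t.im) :
    ‖Complex.exp (2 * Real.pi * Complex.I * t)‖ < 1 := by
  rw [Complex.norm_exp, Real.exp_lt_one_iff]
  have : (2 * Real.pi * Complex.I * t).re = -(2 * Real.pi * t.im) := by simp
  rw [this]
  have := mul_pos Real.two_pi_pos ht
  linarith

theorem hasSum_riemannZeta {k : ℕ} (hk : 1 < k) :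
    HasSum (fun j : ℕ => 1 / ((j : ℂ) + 1) ^ k) (riemannZeta k) := by
  have hs : Summable fun j : ℕ => 1 / (j : ℂ) ^ k := by
    have h := Real.summable_one_div_nat_pow.mpr hk
    exact (Complex.summable_ofReal.mpr h).congr fun j => by push_cast; rfl
  have h1 := (hasSum_nat_add_iff' 1).mpr hs.hasSum
  rw [← zeta_nat_eq_tsum_of_gt_one hk] at h1
  simpa [show k ≠ 0 by omega] using h1

theorem hasSum_cot {k : ℕ} (hk : 1 < k) {t : ℂ} (ht : 0 < t.im) :
    HasSum (fun j : ℕ => 1 / ((j : ℂ) + 1) ^ k *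
      (Real.pi * Complex.cot (Real.pi * (((j : ℂ) + 1) * t))))
      (-2 * Real.pi * Complex.I * lambertEichler k t) := by
  have hx := norm_exp_two_pi_I_mul_lt_one ht
  have h := (((hasSum_riemannZeta hk).div_const 2).add (hasSum_complexLambert k hx)).mul_left
    (-2 * Real.pi * Complex.I)
  rw [← lambertEichler] at h
  convert! h using 2 with j
  have h1 := one_sub_pow_succ_ne_zero hx j
  have h2 : Complex.exp (2 * Real.pi * Complex.I * (((j : ℂ) + 1) * t)) =
      Complex.exp (2 * Real.pi * Complex.I * t) ^ (j + 1) := by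
    rw [← Complex.exp_nat_mul]; congr 1; push_cast; ring
  rw [Complex.cot_pi_eq_exp_ratio, h2]
  generalize Complex.exp (2 * Real.pi * Complex.I * t) ^ (j + 1) = y at *
  have h3 : (y + 1) / (Complex.I * (1 - y)) = -Complex.I * (1 + 2 * (y / (1 - y))) := by
    have := Complex.I_ne_zero
    field_simp
    linear_combination (1 + y) * Complex.I_sq
  rw [h3]
  ring

theorem mul_mem_integerComplement {t : ℂ} (ht : 0 < t.im) (j : ℕ) :
    ((j : ℂ) + 1) * t ∈ Complex.integerComplement := by
  rw [Complex.mem_integerComplement_iff]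
  rintro ⟨m, hm⟩
  have h := congrArg Complex.im hm
  simp at h
  rcases h with h | h
  · have : (0 : ℝ) ≤ j := Nat.cast_nonneg j
    linarith
  · exact ht.ne' h

theorem hasSum_cot_partial_fractions {t : ℂ} (ht : 0 < t.im) (j : ℕ) :
    HasSum (fun m : ℕ => 2 * (((j : ℂ) + 1) * t) *
        (1 / ((((j : ℂ) + 1) * t) ^ 2 - ((m : ℂ) + 1) ^ 2)))
      (Real.pi * Complex.cot (Real.pi * (((j : ℂ) + 1) * t)) - 1 / (((j : ℂ) + 1) * t)) := by
  have hz := mul_mem_integerComplement ht j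
  have h := (summable_cotTerm hz).hasSum
  have h1 := cot_series_rep' hz
  simp only [cotTerm] at h
  rw [← h1] at h
  convert! h using 2 with m
  have h2 := cotTerm_identity hz m
  rw [cotTerm] at h2
  rw [h2]
  congr 2
  ring

/-- The bound is uniform in `j`, which makes the double series absolutely convergent. -/
theorem norm_one_div_sq_sub_sq_le {t : ℂ} (ht : 0 < t.im) (j m : ℕ) :
    ‖1 / ((((j : ℂ) + 1) * t) ^ 2 - ((m : ℂ) + 1) ^ 2)‖ ≤
      (‖t‖ / t.im) ^ 2 * (1 / ((m : ℝ) + 1) ^ 2) := by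
  have ht0 : 0 < ‖t‖ := norm_pos_iff.mpr fun h => by simp [h] at ht
  have key : ∀ s : ℝ, |s| = (m : ℝ) + 1 →
      ((m : ℝ) + 1) * t.im / ‖t‖ ≤ ‖((j : ℂ) + 1) * t - s‖ := by
    intro s hs
    -- Multiplying by the conjugate of `t` makes the `j`-term real, leaving the imaginary part `s *
    -- t.im`.
    rw [div_le_iff₀ ht0, ← Complex.norm_conj t, ← norm_mul]
    refine le_trans (le_of_eq ?_) (Complex.abs_im_le_norm _)
    have : (((((j : ℂ) + 1) * t - s) * (starRingEnd ℂ) t)).im = s * t.im := by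
      simp; ring
    rw [this, abs_mul, hs, abs_of_pos ht]
  have hm : (0 : ℝ) < (m : ℝ) + 1 := by positivity
  have h1 := key (m + 1) (abs_of_pos hm)
  have h2 := key (-(m + 1)) (by rw [abs_neg, abs_of_pos hm])
  have hf : (((j : ℂ) + 1) * t) ^ 2 - ((m : ℂ) + 1) ^ 2 =
      (((j : ℂ) + 1) * t - ((m + 1 : ℝ) : ℂ)) * (((j : ℂ) + 1) * t - ((-(m + 1) : ℝ) : ℂ)) := by
    push_cast; ring
  rw [hf, norm_div, norm_one, norm_mul]
  have hp : 0 < ((m : ℝ) + 1) * t.im / ‖t‖ := by positivity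
  calc _ ≤ 1 / ((((m : ℝ) + 1) * t.im / ‖t‖) * (((m : ℝ) + 1) * t.im / ‖t‖)) := by gcongr
    _ = _ := by field_simp

theorem summable_double {n : ℕ} (hn : 1 ≤ n) {t : ℂ} (ht : 0 < t.im) :
    Summable fun p : ℕ × ℕ => 1 / ((p.1 : ℂ) + 1) ^ (2 * n) *
      (1 / ((((p.1 : ℂ) + 1) * t) ^ 2 - ((p.2 : ℂ) + 1) ^ 2)) := by
  have hs : ∀ k : ℕ, 1 < k → Summable fun j : ℕ => 1 / ((j : ℝ) + 1) ^ k := fun k hk => by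
    have := (summable_nat_add_iff 1).mpr (Real.summable_one_div_nat_pow.mpr hk)
    exact_mod_cast this
  have h := (hs (2 * n) (by omega)).mul_of_nonneg ((hs 2 (by norm_num)).mul_left ((‖t‖ / t.im) ^ 2))
    (fun j => by positivity) (fun j => by positivity)
  refine Summable.of_norm_bounded h fun p => ?_
  rw [norm_mul]
  refine mul_le_mul (le_of_eq ?_) (norm_one_div_sq_sub_sq_le ht _ _) (norm_nonneg _) (by positivity)
  rw [norm_div, norm_one, norm_pow, show ((p.1 : ℂ) + 1) = ((p.1 + 1 : ℕ) : ℂ) by push_cast; rfl,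
      Complex.norm_natCast]
  push_cast; rfl

theorem hasSum_double {n : ℕ} (hn : 1 ≤ n) {t : ℂ} (ht : 0 < t.im) :
    HasSum (fun p : ℕ × ℕ => 1 / ((p.1 : ℂ) + 1) ^ (2 * n) *
      (1 / ((((p.1 : ℂ) + 1) * t) ^ 2 - ((p.2 : ℂ) + 1) ^ 2)))
      ((-2 * Real.pi * Complex.I * lambertEichler (2 * n + 1) t
        - riemannZeta ((2 * n + 2 : ℕ) : ℂ) / t) / (2 * t)) := by
  have ht0 : t ≠ 0 := fun h => by simp [h] at ht
  have hs := (summable_double hn ht).hasSum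
  have hfib : ∀ j : ℕ, HasSum (fun m : ℕ => 1 / ((j : ℂ) + 1) ^ (2 * n) *
      (1 / ((((j : ℂ) + 1) * t) ^ 2 - ((m : ℂ) + 1) ^ 2)))
      ((1 / ((j : ℂ) + 1) ^ (2 * n + 1) * (Real.pi * Complex.cot (Real.pi * (((j : ℂ) + 1) * t)))
        - 1 / ((j : ℂ) + 1) ^ (2 * n + 2) / t) / (2 * t)) := by
    intro j
    have hj : ((j : ℂ) + 1) ≠ 0 := by exact_mod_cast (by omega : j + 1 ≠ 0)
    convert! (hasSum_cot_partial_fractions ht j).mul_left (1 / ((j : ℂ) + 1) ^ (2 * n + 1) / (2 * t))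
      using 1
    · funext m
      generalize 1 / ((((j : ℂ) + 1) * t) ^ 2 - ((m : ℂ) + 1) ^ 2) = D
      rw [pow_succ]
      field_simp
    · generalize Real.pi * Complex.cot (Real.pi * (((j : ℂ) + 1) * t)) = D
      rw [show 2 * n + 2 = 2 * n + 1 + 1 by ring, pow_succ _ (2 * n + 1)]
      field_simp
  have h1 := hs.prod_fiberwise hfib
  have h2 := ((hasSum_cot (k := 2 * n + 1) (by omega) ht).sub
    ((hasSum_riemannZeta (k := 2 * n + 2) (by omega)).div_const t)).div_const (2 * t)
  rw [← h1.unique h2]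
  exact hs

/-- This is `hasSum_double` at `-1/t` with the indices exchanged; the denominators then agree up to
the factor `-1/t²`. -/
theorem hasSum_double_swap {n : ℕ} (hn : 1 ≤ n) {t : ℂ} (ht : 0 < t.im) :
    HasSum (fun p : ℕ × ℕ => 1 / ((p.2 : ℂ) + 1) ^ (2 * n) *
      (1 / ((((p.1 : ℂ) + 1) * t) ^ 2 - ((p.2 : ℂ) + 1) ^ 2)))
      ((-2 * Real.pi * Complex.I * lambertEichler (2 * n + 1) (-1 / t)
        + riemannZeta ((2 * n + 2 : ℕ) : ℂ) * t) / (2 * t)) := by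
  have ht0 : t ≠ 0 := fun h => by simp [h] at ht
  have hi : 0 < (-1 / t).im := by
    rw [neg_div, one_div, Complex.neg_im, Complex.inv_im, neg_div, neg_neg]
    exact div_pos ht (Complex.normSq_pos.mpr ht0)
  have h := ((Equiv.prodComm ℕ ℕ).hasSum_iff.mpr (hasSum_double hn hi)).mul_left (-1 / t ^ 2)
  convert! h using 1
  · funext p
    simp only [Function.comp, Equiv.prodComm_apply, Prod.fst_swap, Prod.snd_swap]
    rw [mul_left_comm]
    congr 1
    rw [div_mul_div_comm]
    have : t ^ 2 * ((((p.2 : ℂ) + 1) * (-1 / t)) ^ 2 - ((p.1 : ℂ) + 1) ^ 2) =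
        -((((p.1 : ℂ) + 1) * t) ^ 2 - ((p.2 : ℂ) + 1) ^ 2) := by
      field_simp; ring
    rw [this, mul_one, neg_div_neg_eq]
  · field_simp
    ring

/-- The geometric sum for `(Jt)^{2n} - M^{2n}` cancels the mixed denominator, so the variables `J`
and `M` separate. -/
theorem sq_sub_sq_inv_pow_identity (n : ℕ) {J M t : ℂ} (hJ : J ≠ 0) (hM : M ≠ 0)
    (h : (J * t) ^ 2 - M ^ 2 ≠ 0) :
    1 / J ^ (2 * n) * (1 / ((J * t) ^ 2 - M ^ 2)) -
      t ^ (2 * n) * (1 / M ^ (2 * n) * (1 / ((J * t) ^ 2 - M ^ 2))) =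
    -∑ i ∈ Finset.range n, t ^ (2 * i) * (1 / J ^ (2 * (n - i)) * (1 / M ^ (2 * i + 2))) := by
  have hg := (Commute.all ((J * t) ^ 2) (M ^ 2)).mul_geom_sum₂ n
  have hs : ∑ i ∈ Finset.range n, t ^ (2 * i) * (1 / J ^ (2 * (n - i)) * (1 / M ^ (2 * i + 2))) =
      (∑ i ∈ Finset.range n, ((J * t) ^ 2) ^ i * (M ^ 2) ^ (n - 1 - i)) /
        (J ^ (2 * n) * M ^ (2 * n)) := by
    rw [Finset.sum_div]
    refine Finset.sum_congr rfl fun i hi => ?_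
    obtain ⟨d, rfl⟩ := Nat.exists_eq_add_of_lt (Finset.mem_range.mp hi)
    rw [show i + d + 1 - i = d + 1 by omega, show i + d + 1 - 1 - i = d by omega]
    field_simp
    ring
  rw [hs]
  generalize ∑ i ∈ Finset.range n, ((J * t) ^ 2) ^ i * (M ^ 2) ^ (n - 1 - i) = S at *
  rw [← pow_mul, ← pow_mul, mul_pow J t (2 * n)] at hg
  generalize (J * t) ^ 2 - M ^ 2 = D at *
  field_simp
  linear_combination hg

theorem lambertEichler_inversion {n : ℕ} (hn : 1 ≤ n) {t : ℂ} (ht : 0 < t.im) :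
    -2 * Real.pi * Complex.I * (lambertEichler (2 * n + 1) t
      - t ^ (2 * n) * lambertEichler (2 * n + 1) (-1 / t)) =
    riemannZeta ((2 * n + 2 : ℕ) : ℂ) * (1 / t + t ^ (2 * n + 1)) -
      2 * ∑ i ∈ Finset.range n, t ^ (2 * i + 1) *
        (riemannZeta ((2 * (n - i) : ℕ) : ℂ) * riemannZeta ((2 * i + 2 : ℕ) : ℂ)) := by
  have ht0 : t ≠ 0 := fun h => by simp [h] at ht
  have h := (hasSum_double hn ht).sub ((hasSum_double_swap hn ht).mul_left (t ^ (2 * n)))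
  have hz : ∀ i ∈ Finset.range n, HasSum (fun p : ℕ × ℕ => t ^ (2 * i) *
      (1 / ((p.1 : ℂ) + 1) ^ (2 * (n - i)) * (1 / ((p.2 : ℂ) + 1) ^ (2 * i + 2))))
      (t ^ (2 * i) *
        (riemannZeta ((2 * (n - i) : ℕ) : ℂ) * riemannZeta ((2 * i + 2 : ℕ) : ℂ))) := by
    intro i hi
    have hi' := Finset.mem_range.mp hi
    have h1 := hasSum_riemannZeta (k := 2 * (n - i)) (by omega)
    have h2 := hasSum_riemannZeta (k := 2 * i + 2) (by omega)
    have h3 := summable_mul_of_summable_norm h1.summable.norm h2.summable.norm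
    have h4 := h1.mul h2 h3
    exact h4.mul_left _
  have h' := (hasSum_sum hz).neg
  have hfun : (fun p : ℕ × ℕ => 1 / ((p.1 : ℂ) + 1) ^ (2 * n) *
      (1 / ((((p.1 : ℂ) + 1) * t) ^ 2 - ((p.2 : ℂ) + 1) ^ 2)) - t ^ (2 * n) *
      (1 / ((p.2 : ℂ) + 1) ^ (2 * n) *
      (1 / ((((p.1 : ℂ) + 1) * t) ^ 2 - ((p.2 : ℂ) + 1) ^ 2)))) =
      fun p : ℕ × ℕ => -∑ i ∈ Finset.range n, t ^ (2 * i) *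
      (1 / ((p.1 : ℂ) + 1) ^ (2 * (n - i)) * (1 / ((p.2 : ℂ) + 1) ^ (2 * i + 2))) := by
    funext p
    refine sq_sub_sq_inv_pow_identity n (by exact_mod_cast (by omega : p.1 + 1 ≠ 0))
      (by exact_mod_cast (by omega : p.2 + 1 ≠ 0)) (sub_ne_zero.mpr ?_)
    exact_mod_cast Complex.integerComplement_pow_two_ne_pow_two
      (mul_mem_integerComplement ht p.1) (p.2 + 1 : ℤ)
  rw [hfun] at h
  have e := h.unique h'
  have hsum : ∑ i ∈ Finset.range n, t ^ (2 * i + 1) *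
      (riemannZeta ((2 * (n - i) : ℕ) : ℂ) * riemannZeta ((2 * i + 2 : ℕ) : ℂ)) =
      t * ∑ i ∈ Finset.range n, t ^ (2 * i) *
      (riemannZeta ((2 * (n - i) : ℕ) : ℂ) * riemannZeta ((2 * i + 2 : ℕ) : ℂ)) := by
    rw [Finset.mul_sum]
    exact Finset.sum_congr rfl fun i _ => by ring
  rw [hsum]
  generalize (∑ i ∈ Finset.range n, t ^ (2 * i) *
      (riemannZeta ((2 * (n - i) : ℕ) : ℂ) * riemannZeta ((2 * i + 2 : ℕ) : ℂ))) = S at *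
  field_simp at e ⊢
  linear_combination e

theorem lambertEichler_sub_inversion {n : ℕ} (hn : 1 ≤ n) {t : ℂ} (ht : 0 < t.im) :
    lambertEichler (2 * n + 1) t - t ^ (2 * n) * lambertEichler (2 * n + 1) (-1 / t) =
      -(Complex.I * 2 ^ (2 * n) * Real.pi ^ (2 * n + 1) / (2 * n + 2).factorial
        * bernoulliH n t) := by
  have ht0 : t ≠ 0 := fun h => by simp [h] at ht
  have hpi : (Real.pi : ℂ) ≠ 0 := by exact_mod_cast Real.pi_ne_zero
  have h := lambertEichler_inversion hn ht
  have hB : ∀ m ∈ Finset.range (n + 2),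
      t ^ (2 * (m : ℤ) - 1) * (riemannZeta ((2 * m : ℕ) : ℂ) *
        riemannZeta ((2 * (n + 1 - m) : ℕ) : ℂ)) =
      (2 ^ (2 * n) * Real.pi ^ (2 * n + 2) / (2 * n + 2).factorial) * ((-1) ^ (n + 1) *
        (t ^ (2 * (m : ℤ) - 1) * ((2 * n + 2).choose (2 * m) : ℂ) *
        (bernoulli (2 * m) : ℂ) * (bernoulli (2 * n + 2 - 2 * m) : ℂ))) := by
    intro m hm
    obtain ⟨d, hd⟩ := Nat.exists_eq_add_of_le (Nat.lt_succ_iff.mp (Finset.mem_range.mp hm))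
    have hd' : 2 * n + 2 = 2 * m + 2 * d := by omega
    rw [show n + 1 - m = d by omega, show 2 * n + 2 - 2 * m = 2 * d by omega, hd',
      Nat.cast_add_choose, Nat.cast_mul, Nat.cast_mul, Nat.cast_two, riemannZeta_two_mul_nat',
      riemannZeta_two_mul_nat', hd]
    have hp : (2 : ℂ) ^ (2 * n) = 2 ^ (2 * (m : ℤ) - 1) * 2 ^ (2 * (d : ℤ) - 1) := by
      rw [← zpow_add₀ two_ne_zero, ← zpow_natCast]
      congr 1
      push_cast
      have : ((n + 1 : ℕ) : ℤ) = ((m + d : ℕ) : ℤ) := by rw [hd]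
      push_cast at this
      linarith
    have hf1 : ((2 * m).factorial : ℂ) ≠ 0 := by exact_mod_cast (Nat.factorial_ne_zero _)
    have hf2 : ((2 * d).factorial : ℂ) ≠ 0 := by exact_mod_cast (Nat.factorial_ne_zero _)
    have hf3 : ((2 * m + 2 * d).factorial : ℂ) ≠ 0 := by exact_mod_cast (Nat.factorial_ne_zero _)
    rw [hp]
    generalize (2 : ℂ) ^ (2 * (m : ℤ) - 1) = u
    generalize (2 : ℂ) ^ (2 * (d : ℤ) - 1) = v
    generalize t ^ (2 * (m : ℤ) - 1) = w
    have hs : (-1 : ℂ) ^ (m + 1) * (-1) ^ (d + 1) = (-1) ^ (m + d) := by ring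
    rw [← hs]
    field_simp
    ring
  have hS := Finset.sum_congr rfl hB
  rw [← Finset.mul_sum, ← Finset.mul_sum, ← bernoulliH, Finset.sum_range_succ,
    Finset.sum_range_succ'] at hS
  have e1 : ∑ i ∈ Finset.range n, t ^ (2 * ((i + 1 : ℕ) : ℤ) - 1) *
      (riemannZeta ((2 * (i + 1) : ℕ) : ℂ) * riemannZeta ((2 * (n + 1 - (i + 1)) : ℕ) : ℂ)) =
      ∑ i ∈ Finset.range n, t ^ (2 * i + 1) *
        (riemannZeta ((2 * (n - i) : ℕ) : ℂ) * riemannZeta ((2 * i + 2 : ℕ) : ℂ)) := by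
    refine Finset.sum_congr rfl fun i _ => ?_
    rw [show (2 * ((i + 1 : ℕ) : ℤ) - 1) = ((2 * i + 1 : ℕ) : ℤ) by push_cast; ring, zpow_natCast,
      show 2 * (i + 1) = 2 * i + 2 by ring, show n + 1 - (i + 1) = n - i by omega]
    ring
  rw [e1] at hS
  have e2 : (2 * ((n + 1 : ℕ) : ℤ) - 1) = ((2 * n + 1 : ℕ) : ℤ) := by push_cast; ring
  rw [e2, zpow_natCast] at hS
  -- The two extreme terms contain `ζ(0) = -1/2`; they account for `ζ(2n+2)(1/t + t^{2n+1})`.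
  simp only [Nat.sub_self, mul_zero, Nat.cast_zero, riemannZeta_zero, zero_sub, Nat.sub_zero,
    zpow_neg_one, show 2 * (n + 1) = 2 * n + 2 by ring] at hS
  generalize (∑ i ∈ Finset.range n, t ^ (2 * i + 1) *
      (riemannZeta ((2 * (n - i) : ℕ) : ℂ) * riemannZeta ((2 * i + 2 : ℕ) : ℂ))) = S at *
  generalize lambertEichler (2 * n + 1) t - t ^ (2 * n) * lambertEichler (2 * n + 1) (-1 / t) = X at *
  have h3 : Complex.I * Real.pi * X = (2 ^ (2 * n) * Real.pi ^ (2 * n + 2) /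
      (2 * n + 2).factorial) * bernoulliH n t := by
    rw [← hS]
    linear_combination (-1 / 2) * h
  have h4 : Real.pi * X = -Complex.I * ((2 ^ (2 * n) * Real.pi ^ (2 * n + 2) /
      (2 * n + 2).factorial) * bernoulliH n t) := by
    rw [← h3]
    linear_combination (Real.pi * X) * Complex.I_sq
  apply mul_left_cancel₀ hpi
  rw [h4]
  ring

/-! ### Arithmetic in `ℚ(√-7)`. -/

theorem sqrtNegSeven_sq : sqrtNegSeven ^ 2 = -7 := by
  rw [sqrtNegSeven, mul_pow, Complex.I_sq, ← Complex.ofReal_pow,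
    Real.sq_sqrt (by norm_num)]
  norm_num

theorem conj_sqrtNegSeven : (starRingEnd ℂ) sqrtNegSeven = -sqrtNegSeven := by
  simp [sqrtNegSeven]

theorem sqrtNegSeven_re : sqrtNegSeven.re = 0 := by simp [sqrtNegSeven]

theorem sqrtNegSeven_im : sqrtNegSeven.im = Real.sqrt 7 := by simp [sqrtNegSeven]

theorem exists_int_eq_pow_add_conj_pow (m : ℕ) :
    ∃ p : ℤ, ((1 + sqrtNegSeven) / 2) ^ m + ((1 - sqrtNegSeven) / 2) ^ m = p := by
  induction m using Nat.strong_induction_on with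
  | _ m ih =>
    match m with
    | 0 => exact ⟨2, by norm_num⟩
    | 1 => exact ⟨1, by push_cast; ring⟩
    | m + 2 =>
      obtain ⟨p, hp⟩ := ih m (by omega)
      obtain ⟨r, hr⟩ := ih (m + 1) (by omega)
      -- Both `(1 ± √-7)/2` are roots of `x² = x - 2`.
      refine ⟨r - 2 * p, ?_⟩
      push_cast
      rw [← hp, ← hr]
      linear_combination ((((1 + sqrtNegSeven) / 2) ^ m + ((1 - sqrtNegSeven) / 2) ^ m) / 4) *
        sqrtNegSeven_sq

/-- Membership of a complex number in `ℚ(√-7)`. -/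
def IsQuadraticRational (u : ℂ) : Prop :=
  ∃ p r : ℚ, u = p + r * sqrtNegSeven

theorem IsQuadraticRational.ratCast (p : ℚ) : IsQuadraticRational p := ⟨p, 0, by simp⟩

theorem IsQuadraticRational.mul {u v : ℂ} (hu : IsQuadraticRational u)
    (hv : IsQuadraticRational v) : IsQuadraticRational (u * v) := by
  obtain ⟨p, r, rfl⟩ := hu
  obtain ⟨p', r', rfl⟩ := hv
  refine ⟨p * p' - 7 * r * r', p * r' + r * p', ?_⟩
  push_cast
  linear_combination (r * r' : ℂ) * sqrtNegSeven_sq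

theorem IsQuadraticRational.add {u v : ℂ} (hu : IsQuadraticRational u)
    (hv : IsQuadraticRational v) : IsQuadraticRational (u + v) := by
  obtain ⟨p, r, rfl⟩ := hu
  obtain ⟨p', r', rfl⟩ := hv
  exact ⟨p + p', r + r', by push_cast; ring⟩

theorem IsQuadraticRational.pow {u : ℂ} (hu : IsQuadraticRational u) (m : ℕ) :
    IsQuadraticRational (u ^ m) := by
  induction m with
  | zero => exact ⟨1, 0, by simp⟩
  | succ m ih => rw [pow_succ]; exact ih.mul hu

theorem IsQuadraticRational.sum {ι : Type*} (s : Finset ι) {f : ι → ℂ}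
    (hf : ∀ i ∈ s, IsQuadraticRational (f i)) : IsQuadraticRational (∑ i ∈ s, f i) :=
  Finset.sum_induction f IsQuadraticRational (fun _ _ => .add) ⟨0, 0, by simp⟩ hf

theorem one_add_sqrtNegSeven_div_four_inv :
    ((1 + sqrtNegSeven) / 4)⁻¹ = (1 - sqrtNegSeven) / 2 := by
  refine inv_eq_of_mul_eq_one_right ?_
  linear_combination (-1 / 8) * sqrtNegSeven_sq

theorem isQuadraticRational_bernoulliH (n : ℕ) :
    IsQuadraticRational (bernoulliH n ((1 + sqrtNegSeven) / 4)) := by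
  have hz : IsQuadraticRational ((1 + sqrtNegSeven) / 4) :=
    ⟨1 / 4, 1 / 4, by push_cast; ring⟩
  have hz' : IsQuadraticRational ((1 - sqrtNegSeven) / 2) :=
    ⟨1 / 2, -1 / 2, by push_cast; ring⟩
  have h1 : IsQuadraticRational ((-1) ^ (n + 1)) :=
    IsQuadraticRational.pow ⟨-1, 0, by simp⟩ _
  refine h1.mul (IsQuadraticRational.sum _ fun m _ => ?_)
  refine ((IsQuadraticRational.mul ?_ ?_).mul (.ratCast _)).mul (.ratCast _)
  · cases m with
    | zero =>
      rw [Nat.cast_zero, mul_zero, zero_sub, zpow_neg_one, one_add_sqrtNegSeven_div_four_inv]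
      exact hz'
    | succ m =>
      rw [show (2 * ((m + 1 : ℕ) : ℤ) - 1) = ((2 * m + 1 : ℕ) : ℤ) by push_cast; ring, zpow_natCast]
      exact hz.pow _
  · exact ⟨((2 * n + 2).choose (2 * m) : ℕ), 0, by simp⟩

theorem exists_rat_im_bernoulliH (n : ℕ) :
    ∃ r : ℚ, (bernoulliH n ((1 + sqrtNegSeven) / 4)).im = Real.sqrt 7 * r := by
  obtain ⟨p, r, h⟩ := isQuadraticRational_bernoulliH n
  refine ⟨r, ?_⟩
  rw [h, Complex.add_im, Complex.mul_im, sqrtNegSeven_im, sqrtNegSeven_re]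
  simp [mul_comm]

/-! ### Evaluation at `t = (1+√-7)/4`. -/

theorem q7_pos : 0 < q7 := Real.exp_pos _

theorem q7_lt_one : q7 < 1 := by
  rw [q7, Real.exp_lt_one_iff]
  have := mul_pos Real.pi_pos (Real.sqrt_pos.mpr (by norm_num : (0 : ℝ) < 7))
  linarith

theorem exists_exp_eq_I_mul :
    ∃ r : ℝ, r ^ 2 = q7 ∧
      Complex.exp (2 * Real.pi * Complex.I * ((1 + sqrtNegSeven) / 4)) = Complex.I * r := by
  refine ⟨Real.exp (-Real.pi * Real.sqrt 7 / 2), ?_, ?_⟩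
  · rw [← Real.exp_nat_mul, q7]; congr 1; push_cast; ring
  · have : 2 * Real.pi * Complex.I * ((1 + sqrtNegSeven) / 4) =
        Real.pi / 2 * Complex.I + ((-Real.pi * Real.sqrt 7 / 2 : ℝ) : ℂ) := by
      rw [sqrtNegSeven]
      push_cast
      linear_combination (Real.pi * Real.sqrt 7 / 2 : ℂ) * Complex.I_sq
    rw [this, Complex.exp_add, Complex.exp_pi_div_two_mul_I, Complex.ofReal_exp]

theorem exp_neg_one_div_eq :
    Complex.exp (2 * Real.pi * Complex.I * (-1 / ((1 + sqrtNegSeven) / 4))) = ((-q7 : ℝ) : ℂ) := by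
  have : 2 * Real.pi * Complex.I * (-1 / ((1 + sqrtNegSeven) / 4)) =
      ((-Real.pi * Real.sqrt 7 : ℝ) : ℂ) - Real.pi * Complex.I := by
    rw [neg_div, one_div, one_add_sqrtNegSeven_div_four_inv, sqrtNegSeven]
    push_cast
    linear_combination (Real.pi * Real.sqrt 7 : ℂ) * Complex.I_sq
  rw [this, Complex.exp_sub, Complex.exp_pi_mul_I, q7]
  push_cast
  ring

theorem exists_ofReal_eq_riemannZeta {k : ℕ} (hk : 1 < k) : ∃ Z : ℝ, riemannZeta k = Z :=
  ⟨∑' j : ℕ, 1 / (j : ℝ) ^ k, by rw [zeta_nat_eq_tsum_of_gt_one hk]; push_cast; rfl⟩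

/-- The parity relation on the real line. -/
theorem lambertS_neg (k : ℕ) {q : ℝ} (hq : |q| < 1) :
    lambertS k (-q) = -lambertS k q +
      2 * ((1 + 1 / 2 ^ k) * lambertS k (q ^ 2) - 1 / 2 ^ k * lambertS k (q ^ 4)) := by
  have h := complexLambert_add_neg k (x := (q : ℂ)) (by simpa using hq)
  rw [← Complex.ofReal_neg, ← Complex.ofReal_pow, ← Complex.ofReal_pow, complexLambert_ofReal,
    complexLambert_ofReal, complexLambert_ofReal, complexLambert_ofReal] at h
  have h' : lambertS k q + lambertS k (-q) =
      2 * ((1 + 1 / 2 ^ k) * lambertS k (q ^ 2) - 1 / 2 ^ k * lambertS k (q ^ 4)) := by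
    apply Complex.ofReal_injective
    push_cast at h ⊢
    exact h
  linarith

/-- At a purely imaginary argument the real part of the Lambert series is its even part. -/
theorem complexLambert_I_mul_re (k : ℕ) {r : ℝ} (hr : |r| < 1) :
    (complexLambert k (Complex.I * r)).re =
      (1 + 1 / 2 ^ k) * lambertS k (-r ^ 2) - 1 / 2 ^ k * lambertS k (r ^ 4) := by
  have h := complexLambert_add_neg k (x := Complex.I * r) (by simpa using hr)
  have hc := complexLambert_conj k (Complex.I * r)
  rw [map_mul, Complex.conj_I, Complex.conj_ofReal, neg_mul] at hc
  have e2 : (Complex.I * r : ℂ) ^ 2 = ((-r ^ 2 : ℝ) : ℂ) := by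
    rw [mul_pow, Complex.I_sq]; push_cast; ring
  have e4 : (Complex.I * r : ℂ) ^ 4 = ((r ^ 4 : ℝ) : ℂ) := by
    rw [mul_pow, Complex.I_pow_four]; push_cast; ring
  rw [← hc, Complex.add_conj, e2, e4, complexLambert_ofReal, complexLambert_ofReal] at h
  have h' : 2 * (complexLambert k (Complex.I * r)).re =
      2 * ((1 + 1 / 2 ^ k) * lambertS k (-r ^ 2) - 1 / 2 ^ k * lambertS k (r ^ 4)) := by
    apply Complex.ofReal_injective
    push_cast at h ⊢
    exact h
  linarith

theorem zeta_lambert_relation {n : ℕ} (hn : 1 ≤ n) {Z : ℝ}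
    (hZ : riemannZeta ((2 * n + 1 : ℕ) : ℂ) = Z) :
    (Z / 2 + ((1 + 1 / 2 ^ (2 * n + 1)) * lambertS (2 * n + 1) (-q7) -
        1 / 2 ^ (2 * n + 1) * lambertS (2 * n + 1) (q7 ^ 2))) -
      (((1 + sqrtNegSeven) / 4) ^ (2 * n)).re * (Z / 2 + lambertS (2 * n + 1) (-q7)) =
    2 ^ (2 * n) * Real.pi ^ (2 * n + 1) / (2 * n + 2).factorial *
      (bernoulliH n ((1 + sqrtNegSeven) / 4)).im := by
  have him : 0 < ((1 + sqrtNegSeven) / 4).im := by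
    have : ((1 + sqrtNegSeven) / 4).im = Real.sqrt 7 / 4 := by
      simp [sqrtNegSeven_im]
    rw [this]; positivity
  have h := congrArg Complex.re (lambertEichler_sub_inversion hn him)
  obtain ⟨r, hr, hy⟩ := exists_exp_eq_I_mul
  have hr1 : |r| < 1 := by
    rw [← sq_lt_one_iff_abs_lt_one, hr]; exact q7_lt_one
  have e1 : (lambertEichler (2 * n + 1) ((1 + sqrtNegSeven) / 4)).re =
      Z / 2 + ((1 + 1 / 2 ^ (2 * n + 1)) * lambertS (2 * n + 1) (-q7) -
        1 / 2 ^ (2 * n + 1) * lambertS (2 * n + 1) (q7 ^ 2)) := by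
    rw [lambertEichler, hy, hZ, Complex.add_re, complexLambert_I_mul_re _ hr1, ← hr, ← pow_mul]
    simp
  have e2 : lambertEichler (2 * n + 1) (-1 / ((1 + sqrtNegSeven) / 4)) =
      ((Z / 2 + lambertS (2 * n + 1) (-q7) : ℝ) : ℂ) := by
    rw [lambertEichler, exp_neg_one_div_eq, hZ, complexLambert_ofReal]
    push_cast; rfl
  -- `F(-1/t)` is real, so only the real part of `t^{2n}` enters.
  rw [Complex.sub_re, e1, e2, Complex.re_mul_ofReal] at h
  rw [h]
  have e3 : Complex.I * 2 ^ (2 * n) * Real.pi ^ (2 * n + 1) / (2 * n + 2).factorial =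
      Complex.I * ((2 ^ (2 * n) * Real.pi ^ (2 * n + 1) / (2 * n + 2).factorial : ℝ) : ℂ) := by
    push_cast; ring
  rw [e3, mul_assoc, Complex.neg_re, Complex.I_mul_re, Complex.im_ofReal_mul, neg_neg]

theorem trace_pow_eq_re (n : ℕ) :
    ((1 + sqrtNegSeven) / 2) ^ (2 * n) + ((1 - sqrtNegSeven) / 2) ^ (2 * n) =
      ((2 ^ (2 * n + 1) * (((1 + sqrtNegSeven) / 4) ^ (2 * n)).re : ℝ) : ℂ) := by
  have h1 : (1 + sqrtNegSeven) / 2 = 2 * ((1 + sqrtNegSeven) / 4) := by ring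
  have h2 : (1 - sqrtNegSeven) / 2 = 2 * (starRingEnd ℂ) ((1 + sqrtNegSeven) / 4) := by
    simp only [map_div₀, map_add, map_one, conj_sqrtNegSeven, map_ofNat]; ring
  rw [h1, h2, mul_pow, mul_pow, ← map_pow, ← mul_add, Complex.add_conj]
  push_cast
  ring

/-- Here `|t|² = 1/2`; the bound gives the positivity of `a_n`. -/
theorem re_pow_lt_one {n : ℕ} (hn : 1 ≤ n) : (((1 + sqrtNegSeven) / 4) ^ (2 * n)).re < 1 := by
  refine (Complex.re_le_norm _).trans_lt ?_
  rw [norm_pow, pow_mul]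
  refine pow_lt_one₀ (by positivity) ?_ (by omega)
  rw [← Complex.normSq_eq_norm_sq, Complex.normSq_apply]
  have h7 : Real.sqrt 7 * Real.sqrt 7 = 7 := Real.mul_self_sqrt (by norm_num)
  simp [sqrtNegSeven_im, sqrtNegSeven_re]
  nlinarith

/-! ### Solving for the zeta value. -/

theorem mainTheorem1 (n : ℕ) (hn : 1 ≤ n) :
    ∃ (a : ℤ) (A : ℕ → ℚ),
      0 < a ∧
      (a : ℂ) = 2 ^ (2 * n + 1) - ((1 + sqrtNegSeven) / 2) ^ (2 * n)
        - ((1 - sqrtNegSeven) / 2) ^ (2 * n) ∧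
      A 1 = 2 + 2 / (a : ℚ) ∧
      2 ^ (2 * n) * A 4 = 2 + 2 / (a : ℚ) ∧
      ∑ d ∈ ({1, 2, 4} : Finset ℕ), A d = -2 ∧
      ((2 * n + 3).factorial : ℝ) / 2 ^ (2 * n - 1) * (a : ℝ) * (A 0 : ℝ) =
        (2 * (n : ℝ) + 3) * 2 ^ (2 * n + 3) / Real.sqrt 7 *
          (bernoulliH n ((1 + sqrtNegSeven) / 4)).im ∧
      (∀ d ∈ ({1, 2, 4} : Finset ℕ), Summable (lambertTerm (2 * n + 1) (q7 ^ d))) ∧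
      riemannZeta ((2 * n + 1 : ℕ) : ℂ) =
        (((A 0 : ℝ) * Real.sqrt 7 * Real.pi ^ (2 * n + 1) +
          ∑ d ∈ ({1, 2, 4} : Finset ℕ), (A d : ℝ) * lambertS (2 * n + 1) (q7 ^ d) : ℝ) : ℂ) := by
  obtain ⟨p, hp⟩ := exists_int_eq_pow_add_conj_pow (2 * n)
  obtain ⟨r, hr⟩ := exists_rat_im_bernoulliH n
  obtain ⟨Z, hZ⟩ := exists_ofReal_eq_riemannZeta (k := 2 * n + 1) (by omega)
  have hrel := zeta_lambert_relation hn hZ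
  have htr := trace_pow_eq_re n
  have hc1 := re_pow_lt_one hn
  have habs : |q7| < 1 := by rw [abs_of_pos q7_pos]; exact q7_lt_one
  rw [lambertS_neg _ habs, hr] at hrel
  rw [hp] at htr
  set c : ℝ := (((1 + sqrtNegSeven) / 4) ^ (2 * n)).re
  have hpc : (p : ℝ) = 2 ^ (2 * n + 1) * c := by exact_mod_cast htr
  obtain ⟨a, ha⟩ : ∃ a : ℤ, a = 2 ^ (2 * n + 1) - p := ⟨_, rfl⟩
  have haR : (a : ℝ) = 2 ^ (2 * n + 1) * (1 - c) := by
    rw [ha]; push_cast; rw [hpc]; ring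
  have ha0R : (0 : ℝ) < a := by
    rw [haR]; exact mul_pos (by positivity) (by linarith)
  have ha0 : 0 < a := by exact_mod_cast ha0R
  have haQ : (a : ℚ) ≠ 0 := by exact_mod_cast ha0.ne'
  have h7 : Real.sqrt 7 ≠ 0 := by positivity
  have hfac : ((2 * n + 3).factorial : ℝ) = (2 * n + 3) * (2 * n + 2).factorial := by
    rw [Nat.factorial_succ]; push_cast; ring
  have hf0 : ((2 * n + 2).factorial : ℝ) ≠ 0 := by exact_mod_cast Nat.factorial_ne_zero _
  -- The coefficients come from multiplying `hrel` by `2/(1-c) = 2^{2n+2}/a`; the last branch serves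
  -- `d = 2` and is fixed by the sum `-2`.
  refine ⟨a, fun d => if d = 0 then 2 ^ (4 * n + 2) * r / ((2 * n + 2).factorial * a) else
    if d = 1 then 2 + 2 / a else if d = 4 then (2 + 2 / a) / 2 ^ (2 * n) else
    -2 - (2 + 2 / a) - (2 + 2 / a) / 2 ^ (2 * n), ha0, ?_, ?_, ?_, ?_, ?_, ?_, ?_⟩
  · rw [ha]; push_cast; rw [← hp]; ring
  · simp
  · simp only [OfNat.ofNat_ne_zero, if_false, if_true, OfNat.ofNat_ne_one]
    field_simp
  · simp
  · rw [hr, hfac]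
    simp only [if_true]
    push_cast
    -- The truncated exponent `2 * n - 1` is a true difference because `1 ≤ n`.
    have h4 : (2 : ℝ) ^ (4 * n + 2) = 2 ^ (2 * n - 1) * 2 ^ (2 * n + 3) := by
      rw [← pow_add]; congr 1; omega
    rw [h4]
    field_simp
  · intro d hd
    refine summable_lambertTerm _ ?_
    rw [abs_pow]
    refine pow_lt_one₀ (abs_nonneg _) habs ?_
    rintro rfl
    simp at hd
  · rw [hZ]
    congr 1
    simp only [Finset.mem_insert, Finset.mem_singleton, OfNat.one_ne_ofNat, or_self,
      not_false_eq_true, Finset.sum_insert, Finset.sum_singleton, OfNat.ofNat_ne_zero, if_false,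
      if_true, one_ne_zero, OfNat.ofNat_ne_one, Nat.reduceEqDiff, pow_one]
    push_cast
    generalize lambertS (2 * n + 1) q7 = L1 at *
    generalize lambertS (2 * n + 1) (q7 ^ 2) = L2 at *
    generalize lambertS (2 * n + 1) (q7 ^ 4) = L4 at *
    have hc : c = 1 - a / (2 * 2 ^ (2 * n)) := by
      rw [haR, pow_succ]; field_simp; ring
    rw [hc, pow_succ (2 : ℝ)] at hrel
    rw [show 4 * n + 2 = 2 * n + 2 * n + 2 by ring, pow_add, pow_add]
    have h2 : (2 : ℝ) ^ (2 * n) ≠ 0 := by positivity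
    have ha' := ha0R.ne'
    generalize (2 : ℝ) ^ (2 * n) = T at *
    generalize Real.pi ^ (2 * n + 1) = P at *
    generalize ((2 * n + 2).factorial : ℝ) = F at *
    generalize (a : ℝ) = b at *
    field_simp at hrel ⊢
    linear_combination hrel
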